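/- Let $\mathcal H$ be a complex Hilbert space, let $\Theta$ and $U$ be compact metric spaces with $\Theta\neq\emptyset$, and let $\mathcal P(\Theta)$ be the set of Borel probability measures on $\Theta$. Let $\rho$ assign to each $\theta\in\Theta$ a density operator on $\mathcal H$ (a positive trace-class operator with $\operatorname{Tr}\rho(\theta)=1$), and assume that $\rho$ is regular: for every compact $K\subseteq\Theta$, $$\lim_{\delta\downarrow 0}\ \inf\bigl\{\|X\|_1 : X \text{ trace class},\ -X\le\rho(\theta)-\rho(\eta)\le X\ \text{ for all }\theta,\eta\in K\text{ with }d(\theta,\eta)<\delta\bigr\}=0 .$$ Let $w:\Theta\times U\to\mathbb R$ be a continuous loss function. A POVM is a map $M$ from the Borel sets of $U$ to the positive bounded operators on $\mathcal H$ that is countably additive in the weak operator topology and satisfies $M(U)=I$. The set of POVMs carries the topology generated by the sets $$\Bigl\{M' : \Bigl|\int_U f(u)\operatorname{Tr}\bigl(T\,M(du)\bigr)-\int_U f(u)\operatorname{Tr}\bigl(T\,M'(du)\bigr)\Bigr|<\varepsilon\Bigr\},$$ where $M$ is a POVM, $\varepsilon>0$, $T$ is a positive trace-class operator and $f\in C(U)$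 is real-valued. Let $\mathcal C$ be a nonempty closed convex set of POVMs (convex combinations are taken setwise). For $M\in\mathcal C$ put $R_M(\theta)=\int_U w(\theta,u)\operatorname{Tr}\bigl(\rho(\theta)M(du)\bigr)$. Call $M\in\mathcal C$ minimax if it minimizes $\sup_{\theta}R_M(\theta)$ over $\mathcal C$, and Bayes with respect to $\pi\in\mathcal P(\Theta)$ if it minimizes $\int R_M\,d\pi$ over $\mathcal C$. Call $\pi_*\in\mathcal P(\Theta)$ least favorable if $$\inf_{M\in\mathcal C}\int R_M\,d\pi_*=\sup_{\pi\in\mathcal P(\Theta)}\ \inf_{M\in\mathcal C}\int R_M\,d\pi .$$ Then: 1. A least favorable prior exists. 2. For every least favorable prior $\pi$, every minimax POVM is Bayes with respect to $\pi$. 3. Every minimax POVM is Bayes with respect to some least favorable prior. 4. If $\pi$ is a least favorable prior and $M$ is the unique Bayes POVM with respect to $\pi$, then $M$ is minimax. -/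

import Mathlib

open MeasureTheory Topology Filter
open scoped ENNReal InnerProductSpace

noncomputable section

namespace QStat

variable {H : Type*} [NormedAddCommGroup H] [InnerProductSpace ℂ H] [CompleteSpace H]

/-! ### Trace and trace norm of operators on a complex Hilbert space -/

/-- A Hilbert basis of `H`, used to define traces.  The trace norm and the trace of a trace-class
operator do not depend on it. -/
def stdBasis (H : Type*) [NormedAddCommGroup H] [InnerProductSpace ℂ H] [CompleteSpace H] :
    HilbertBasis (exists_hilbertBasis ℂ H).choose ℂ H :=
  (exists_hilbertBasis ℂ H).choose_spec.choose

/-- The trace norm `‖A‖₁ = Tr |A|`, as an extended nonnegative number. -/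
def traceNorm (A : H →L[ℂ] H) : ℝ≥0∞ :=
  ∑' i, ENNReal.ofReal (⟪stdBasis H i, CFC.abs A (stdBasis H i)⟫_ℂ).re

/-- `A` is trace class: `‖A‖₁ < ∞`. -/
def IsTraceClass (A : H →L[ℂ] H) : Prop := traceNorm A < ∞

/-- The trace `Tr A` (meaningful for trace-class `A`). -/
def opTrace (A : H →L[ℂ] H) : ℂ :=
  ∑' i, ⟪stdBasis H i, A (stdBasis H i)⟫_ℂ

/-- Positive trace-class operators. -/
structure PosTraceClass (H : Type*) [NormedAddCommGroup H] [InnerProductSpace ℂ H]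
    [CompleteSpace H] where
  /-- the underlying operator -/
  op : H →L[ℂ] H
  nonneg : 0 ≤ op
  traceClass : IsTraceClass op

/-! Helper facts on traces, needed to see that `B ↦ Tr (T M(B))` is a measure. -/

theorem sqrt_inner_swap (T : H →L[ℂ] H) (x y : H) :
    ⟪CFC.sqrt T x, y⟫_ℂ = ⟪x, CFC.sqrt T y⟫_ℂ := by
  have h : IsSelfAdjoint (CFC.sqrt T) := IsSelfAdjoint.of_nonneg (CFC.sqrt_nonneg T)
  exact (ContinuousLinearMap.isSelfAdjoint_iff_isSymmetric.mp h) x y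

theorem inner_op_eq_sqrt (T : PosTraceClass H) (x y : H) :
    ⟪x, T.op y⟫_ℂ = ⟪CFC.sqrt T.op x, CFC.sqrt T.op y⟫_ℂ := by
  rw [sqrt_inner_swap]
  conv_lhs => rw [← CFC.sqrt_mul_sqrt_self T.op T.nonneg]
  rfl

theorem summable_sqrt_sq (T : PosTraceClass H) :
    Summable fun j => ‖CFC.sqrt T.op (stdBasis H j)‖ ^ 2 := by
  have h := T.traceClass
  unfold IsTraceClass traceNorm at h
  rw [CFC.abs_of_nonneg T.op T.nonneg] at h
  have h2 := ENNReal.summable_toReal h.ne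
  refine h2.congr fun j => ?_
  have h3 : (⟪stdBasis H j, T.op (stdBasis H j)⟫_ℂ).re
      = ‖CFC.sqrt T.op (stdBasis H j)‖ ^ 2 := by
    rw [inner_op_eq_sqrt, inner_self_eq_norm_sq_to_K]
    norm_cast
  rw [h3, ENNReal.toReal_ofReal (sq_nonneg _)]

/-- For positive trace-class `T` and bounded `A`, `Tr (T A) = Tr (√T A √T)`, the left-hand side
being computed in an arbitrary Hilbert basis. -/
theorem hasSum_trace_mul {ι : Type*} (b : HilbertBasis ι ℂ H) (T : PosTraceClass H)
    (A : H →L[ℂ] H) :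
    HasSum (fun i => ⟪b i, (T.op * A) (b i)⟫_ℂ)
      (∑' j, ⟪CFC.sqrt T.op (stdBasis H j), A (CFC.sqrt T.op (stdBasis H j))⟫_ℂ) := by
  set S := CFC.sqrt T.op with hS
  set e := stdBasis H with he
  have parseval : ∀ x : H, HasSum (fun i => ‖⟪b i, x⟫_ℂ‖ ^ 2) (‖x‖ ^ 2) := by
    intro x
    have h := b.hasSum_inner_mul_inner x x
    have h' := (Complex.hasSum_iff _ _).mp h |>.1
    rw [show (⟪x, x⟫_ℂ).re = ‖x‖ ^ 2 from inner_self_eq_norm_sq (𝕜 := ℂ) x] at h'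
    convert h' using 2 with i
    rw [← inner_conj_symm x (b i), ← Complex.normSq_eq_conj_mul_self, Complex.normSq_eq_norm_sq]
    exact (Complex.ofReal_re _).symm
  have hsum := summable_sqrt_sq T
  -- the double family
  let g : ι × _ → ℂ := fun p => ⟪S (b p.1), e p.2⟫_ℂ * ⟪e p.2, S (A (b p.1))⟫_ℂ
  have e1 : ∀ i j, ⟪S (b i), e j⟫_ℂ = ⟪b i, S (e j)⟫_ℂ := fun i j => sqrt_inner_swap _ _ _
  have e2 : ∀ i j, ⟪e j, S (A (b i))⟫_ℂ = ⟪A.adjoint (S (e j)), b i⟫_ℂ := fun i j => by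
    rw [ContinuousLinearMap.adjoint_inner_left, sqrt_inner_swap]
  have dbl : ∀ F : _ → H, Summable (fun j => ‖F j‖ ^ 2) →
      Summable (fun p : ι × (exists_hilbertBasis ℂ H).choose => ‖⟪b p.1, F p.2⟫_ℂ‖ ^ 2) := by
    intro F hF
    rw [← (Equiv.prodComm _ _).summable_iff]
    refine (summable_prod_of_nonneg fun p => sq_nonneg _).mpr ⟨fun j => ?_, ?_⟩
    · exact (parseval (F j)).summable
    · refine hF.congr fun j => ?_
      exact (parseval (F j)).tsum_eq.symm
  have hg : Summable g := by
    have s1 := dbl (fun j => S (e j)) hsum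
    have s2 := dbl (fun j => A.adjoint (S (e j))) <| by
      refine Summable.of_nonneg_of_le (fun j => by positivity) (fun j => ?_)
        (hsum.mul_left (‖A.adjoint‖ ^ 2))
      rw [← mul_pow]
      gcongr
      exact ContinuousLinearMap.le_opNorm _ _
    refine Summable.of_norm_bounded (s1.add s2) fun p => ?_
    simp only [g, e1, e2, norm_mul]
    rw [norm_inner_symm (A.adjoint _)]
    nlinarith [sq_nonneg (‖⟪b p.1, S (e p.2)⟫_ℂ‖ - ‖⟪b p.1, A.adjoint (S (e p.2))⟫_ℂ‖),
      sq_nonneg ‖⟪b p.1, S (e p.2)⟫_ℂ‖, sq_nonneg ‖⟪b p.1, A.adjoint (S (e p.2))⟫_ℂ‖]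
  have h1 : HasSum (fun i => ⟪b i, (T.op * A) (b i)⟫_ℂ) (∑' p, g p) := by
    refine hg.hasSum.prod_fiberwise fun i => ?_
    have := e.hasSum_inner_mul_inner (S (b i)) (S (A (b i)))
    rw [← inner_op_eq_sqrt] at this
    exact this
  have h2 : HasSum (fun j => ⟪S (e j), A (S (e j))⟫_ℂ) (∑' p, g p) := by
    have h3 := (Equiv.prodComm _ _).hasSum_iff.mpr hg.hasSum
    refine h3.prod_fiberwise fun j => ?_
    have := b.hasSum_inner_mul_inner (A.adjoint (S (e j))) (S (e j))
    rw [ContinuousLinearMap.adjoint_inner_left] at this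
    have hfun : (fun i => (g ∘ ⇑(Equiv.prodComm _ _)) (j, i)) =
        fun i => ⟪A.adjoint (S (e j)), b i⟫_ℂ * ⟪b i, S (e j)⟫_ℂ := by
      funext i
      simp only [g, Function.comp, Equiv.prodComm_apply, Prod.swap, e1, e2]
      ring
    rw [hfun]
    exact this
  rw [h2.tsum_eq]
  exact h1

theorem summable_sqrt_inner (T : PosTraceClass H) (A : H →L[ℂ] H) :
    Summable fun j => ⟪CFC.sqrt T.op (stdBasis H j), A (CFC.sqrt T.op (stdBasis H j))⟫_ℂ := by
  refine Summable.of_norm_bounded ((summable_sqrt_sq T).mul_left ‖A‖) fun j => ?_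
  calc _ ≤ ‖CFC.sqrt T.op (stdBasis H j)‖ * ‖A (CFC.sqrt T.op (stdBasis H j))‖ :=
        norm_inner_le_norm _ _
    _ ≤ ‖CFC.sqrt T.op (stdBasis H j)‖ * (‖A‖ * ‖CFC.sqrt T.op (stdBasis H j)‖) := by
        gcongr; exact A.le_opNorm _
    _ = _ := by ring

set_option linter.unusedSectionVars false in
theorem re_inner_nonneg {A : H →L[ℂ] H} (hA : 0 ≤ A) (x : H) : 0 ≤ (⟪x, A x⟫_ℂ).re :=
  ((ContinuousLinearMap.nonneg_iff_isPositive A).mp hA).re_inner_nonneg_right x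

theorem ofReal_trace_mul (T : PosTraceClass H) {A : H →L[ℂ] H} (hA : 0 ≤ A) :
    ENNReal.ofReal (opTrace (T.op * A)).re =
      ∑' j, ENNReal.ofReal
        (⟪CFC.sqrt T.op (stdBasis H j), A (CFC.sqrt T.op (stdBasis H j))⟫_ℂ).re := by
  have hs := summable_sqrt_inner T A
  rw [opTrace, (hasSum_trace_mul (stdBasis H) T A).tsum_eq, Complex.re_tsum hs]
  exact ENNReal.ofReal_tsum_of_nonneg (fun j => re_inner_nonneg hA _)
    ((Complex.hasSum_iff _ _).mp hs.hasSum).1.summable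

/-! ### POVMs -/

/-- A positive-operator-valued measure on `U` with values in the bounded operators on `H`; the
value on non-measurable sets is `0` by convention.  Countable additivity is in the weak operator
topology. -/
structure POVM (U : Type*) [MeasurableSpace U] (H : Type*) [NormedAddCommGroup H]
    [InnerProductSpace ℂ H] [CompleteSpace H] where
  /-- the operator `M(B)` -/
  toFun : Set U → H →L[ℂ] H
  nonneg : ∀ B, MeasurableSet B → 0 ≤ toFun B
  not_measurable : ∀ B, ¬ MeasurableSet B → toFun B = 0
  iUnion : ∀ B : ℕ → Set U, (∀ j, MeasurableSet (B j)) → Pairwise (Function.onFun Disjoint B) →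
    ∀ x y : H, HasSum (fun j => ⟪x, toFun (B j) y⟫_ℂ) ⟪x, toFun (⋃ j, B j) y⟫_ℂ
  univ : toFun Set.univ = 1

variable {U : Type*} [MeasurableSpace U]

theorem POVM.inner_empty (M : POVM U H) (x y : H) : ⟪x, M.toFun ∅ y⟫_ℂ = 0 := by
  have h := M.iUnion (fun _ => ∅) (fun _ => MeasurableSet.empty)
    (fun i j _ => by simp [Function.onFun]) x y
  exact summable_const_iff _ |>.mp h.summable

/-- The finite measure `μ_{T,M}(B) = Tr (T M(B))`; for a density operator `T` this is the
distribution of the outcome of `M` (Born rule). -/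
def bornMeasure (T : PosTraceClass H) (M : POVM U H) : Measure U :=
  Measure.ofMeasurable (fun B _ => ENNReal.ofReal (opTrace (T.op * M.toFun B)).re)
    (by
      rw [ofReal_trace_mul T (M.nonneg _ MeasurableSet.empty)]
      simp [M.inner_empty])
    (by
      intro B hB hd
      rw [ofReal_trace_mul T (M.nonneg _ (MeasurableSet.iUnion hB))]
      simp_rw [fun i => ofReal_trace_mul T (M.nonneg _ (hB i))]
      rw [ENNReal.tsum_comm]
      congr 1
      funext j
      have h := ((Complex.hasSum_iff _ _).mp (M.iUnion B hB hd
        (CFC.sqrt T.op (stdBasis H j)) (CFC.sqrt T.op (stdBasis H j)))).1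
      rw [← h.tsum_eq]
      exact ENNReal.ofReal_tsum_of_nonneg (fun i => re_inner_nonneg (M.nonneg _ (hB i)) _)
        h.summable)

theorem bornMeasure_apply (T : PosTraceClass H) (M : POVM U H) {B : Set U}
    (hB : MeasurableSet B) :
    bornMeasure T M B = ENNReal.ofReal (opTrace (T.op * M.toFun B)).re :=
  Measure.ofMeasurable_apply B hB

/-- The subbasic neighbourhood of `M` given by `ε`, `T` and `f`. -/
def POVM.nbhd [TopologicalSpace U] (M : POVM U H) (ε : ℝ) (T : PosTraceClass H) (f : C(U, ℝ)) :
    Set (POVM U H) :=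
  {M' | |∫ u, f u ∂(bornMeasure T M) - ∫ u, f u ∂(bornMeasure T M')| < ε}

/-- The weak topology on POVMs, generated by the neighbourhoods above. -/
instance [TopologicalSpace U] : TopologicalSpace (POVM U H) :=
  TopologicalSpace.generateFrom
    {s | ∃ (M : POVM U H) (ε : ℝ) (T : PosTraceClass H) (f : C(U, ℝ)), 0 < ε ∧ s = M.nbhd ε T f}

/-- A set of POVMs is convex (with setwise convex combinations `B ↦ s M(B) + t N(B)`). -/
def IsConvex (C : Set (POVM U H)) : Prop := Convex ℝ (POVM.toFun '' C)

/-! ### Quantum statistical models -/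

/-- The infimum of `‖X‖₁` over trace-class `X` with `-X ≤ T θ - T η ≤ X` whenever
`θ, η ∈ K` and `d(θ, η) < δ`. -/
def omega {Θ : Type*} [MetricSpace Θ] (T : Θ → H →L[ℂ] H) (K : Set Θ) (δ : ℝ) : ℝ≥0∞ :=
  ⨅ (X : H →L[ℂ] H) (_ : IsTraceClass X ∧
    ∀ θ ∈ K, ∀ η ∈ K, dist θ η < δ → -X ≤ T θ - T η ∧ T θ - T η ≤ X), traceNorm X

/-- Regularity: `omega T K δ → 0` as `δ ↓ 0`, for every compact `K`. -/
def IsRegular {Θ : Type*} [MetricSpace Θ] (T : Θ → H →L[ℂ] H) : Prop :=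
  ∀ K : Set Θ, IsCompact K → Tendsto (omega T K) (𝓝[>] 0) (𝓝 0)

/-- A quantum statistical model: a family of density operators. -/
structure QModel (Θ : Type*) (H : Type*) [NormedAddCommGroup H] [InnerProductSpace ℂ H]
    [CompleteSpace H] where
  /-- the density operator `ρ(θ)` -/
  state : Θ → PosTraceClass H
  trace_eq_one : ∀ θ, opTrace (state θ).op = 1

/-! ### Risks, minimax and Bayes POVMs, least favorable priors -/

variable {Θ : Type*}

/-- The risk function `R_M(θ) = ∫ w(θ, u) Tr (ρ(θ) M(du))`. -/
def risk (ρ : QModel Θ H) (w : Θ × U → ℝ) (M : POVM U H) (θ : Θ) : ℝ :=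
  ∫ u, w (θ, u) ∂(bornMeasure (ρ.state θ) M)

/-- The worst-case risk `sup_θ R_M(θ)`. -/
def worstRisk (ρ : QModel Θ H) (w : Θ × U → ℝ) (M : POVM U H) : EReal :=
  ⨆ θ, (risk ρ w M θ : EReal)

/-- `M` minimizes the worst-case risk over `C`. -/
def IsMinimax (ρ : QModel Θ H) (w : Θ × U → ℝ) (C : Set (POVM U H)) (M : POVM U H) : Prop :=
  M ∈ C ∧ ∀ N ∈ C, worstRisk ρ w M ≤ worstRisk ρ w N

variable [MeasurableSpace Θ]

/-- The average risk `∫ R_M(θ) π(dθ)`. -/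
def avgRisk (ρ : QModel Θ H) (w : Θ × U → ℝ) (π : ProbabilityMeasure Θ) (M : POVM U H) : ℝ :=
  ∫ θ, risk ρ w M θ ∂(π : Measure Θ)

/-- `M` minimizes the average risk with respect to `π` over `C`. -/
def IsBayes (ρ : QModel Θ H) (w : Θ × U → ℝ) (C : Set (POVM U H)) (π : ProbabilityMeasure Θ)
    (M : POVM U H) : Prop :=
  M ∈ C ∧ ∀ N ∈ C, avgRisk ρ w π M ≤ avgRisk ρ w π N

/-- The smallest average risk `inf_{M ∈ C} ∫ R_M(θ) π(dθ)`. -/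
def infAvgRisk (ρ : QModel Θ H) (w : Θ × U → ℝ) (C : Set (POVM U H))
    (π : ProbabilityMeasure Θ) : EReal :=
  ⨅ M ∈ C, (avgRisk ρ w π M : EReal)

/-- `π` is a least favorable prior relative to the class `C`. -/
def IsLeastFavorable (ρ : QModel Θ H) (w : Θ × U → ℝ) (C : Set (POVM U H))
    (π : ProbabilityMeasure Θ) : Prop :=
  infAvgRisk ρ w C π = ⨆ π' : ProbabilityMeasure Θ, infAvgRisk ρ w C π'

end QStat

end

namespace QStat

variable {H : Type*} [NormedAddCommGroup H] [InnerProductSpace ℂ H] [CompleteSpace H]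
variable {U : Type*} [MeasurableSpace U]

/-! ### Linear relations between finite measures -/

section Relations

variable {ι : Type*} [Fintype ι]

/-! The theorem is a minimax duality, with compactness on the side of the POVMs and separation on
the side of the priors. The POVMs form a compact space. Along an ultrafilter the integrals of `f`
against `vecMeasure N x` converge, and Riesz represents the limits by measures `μ x`. Every linear
relation between quadratic forms survives the limit, so polarization (`exists_operator`,
`exists_povm`) rebuilds a POVM from the `μ x`. The worst-case risk is a supremum of continuous
functions of the POVM, hence a minimax POVM exists. Regularity of the states makes each risk
function continuous on the compact space of parameters (`continuous_risk`), so its supremum is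
attained. Let `v` be the minimax value. The risk functions form a convex set, none of which lies
strictly below `v`. Hahn-Banach and Riesz then give a prior `π₀` under which all average risks are
at least `v` (`exists_probabilityMeasure_le_integral`). A minimax POVM has average risk at most `v`
under every prior, so `π₀` is least favorable with value `v`, and the four claims follow by
comparing with `v`. -/

theorem sum_mul_toNNReal_sub (c a : ι → ℝ) :
    ∑ i, (c i).toNNReal * a i - ∑ i, (-c i).toNNReal * a i = ∑ i, c i * a i := by
  rw [← Finset.sum_sub_distrib]
  refine Finset.sum_congr rfl fun i _ => ?_
  rw [← sub_mul, Real.coe_toNNReal', Real.coe_toNNReal', max_zero_sub_max_neg_zero_eq_self]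

theorem sum_smul_measure_real (c : ι → NNReal) (μ : ι → Measure U) [∀ i, IsFiniteMeasure (μ i)]
    (B : Set U) : (∑ i, c i • μ i).real B = ∑ i, c i * (μ i).real B := by
  simp only [measureReal_def, Measure.coe_finsetSum, Finset.sum_apply, Measure.smul_apply]
  rw [ENNReal.toReal_sum fun i _ => ENNReal.nnreal_smul_ne_top (measure_ne_top _ _)]
  simp [ENNReal.smul_def]

theorem integral_sum_smul_measure (c : ι → NNReal) (μ : ι → Measure U) (f : U → ℝ)
    (hf : ∀ i, Integrable f (μ i)) :
    ∫ u, f u ∂(∑ i, c i • μ i) = ∑ i, c i * ∫ u, f u ∂(μ i) := by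
  rw [integral_finsetSum_measure fun i _ => (hf i).smul_measure_nnreal]
  simp [integral_smul_nnreal_measure, NNReal.smul_def]

/-- A linear relation between finite measures can be tested on sets or on continuous functions. -/
theorem sum_mul_measureReal_eq_zero_iff [MetricSpace U] [CompactSpace U] [BorelSpace U]
    (c : ι → ℝ) (μ : ι → Measure U) [∀ i, IsFiniteMeasure (μ i)] :
    (∀ B, MeasurableSet B → ∑ i, c i * (μ i).real B = 0) ↔
      ∀ f : C(U, ℝ), ∑ i, c i * ∫ u, f u ∂(μ i) = 0 := by
  have hint : ∀ (f : C(U, ℝ)) i, Integrable f (μ i) := fun f i =>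
    (f.continuous.integrable_of_hasCompactSupport (HasCompactSupport.of_compactSpace _))
  constructor
  · intro h f
    -- Separating positive and negative coefficients turns a signed relation into an equality of two
    -- finite positive measures.
    have : ∑ i, (c i).toNNReal • μ i = ∑ i, (-c i).toNNReal • μ i := by
      ext B hB
      rw [← measureReal_eq_measureReal_iff, sum_smul_measure_real, sum_smul_measure_real,
        ← sub_eq_zero, sum_mul_toNNReal_sub, h B hB]
    rw [← sum_mul_toNNReal_sub, ← integral_sum_smul_measure _ _ _ (hint f),
      ← integral_sum_smul_measure _ _ _ (hint f), this, sub_self]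
  · intro h B _
    have : ∑ i, (c i).toNNReal • μ i = ∑ i, (-c i).toNNReal • μ i := by
      refine ext_of_forall_integral_eq_of_IsFiniteMeasure fun f => ?_
      have := h f.toContinuousMap
      rw [← sum_mul_toNNReal_sub, ← integral_sum_smul_measure _ _ _ (hint _),
        ← integral_sum_smul_measure _ _ _ (hint _), sub_eq_zero] at this
      exact this
    rw [← sum_mul_toNNReal_sub, ← sum_smul_measure_real, ← sum_smul_measure_real, this, sub_self]

end Relations

/-- **Riesz representation** on a compact space. -/
theorem exists_measure_of_nonneg {X : Type*} [TopologicalSpace X] [T2Space X] [CompactSpace X]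
    [MeasurableSpace X] [BorelSpace X] (Λ : C(X, ℝ) →ₗ[ℝ] ℝ) (hΛ : ∀ f, 0 ≤ f → 0 ≤ Λ f) :
    ∃ μ : Measure X, IsFiniteMeasure μ ∧ ∀ f : C(X, ℝ), ∫ x, f x ∂μ = Λ f := by
  let L : CompactlySupportedContinuousMap X ℝ →ₗ[ℝ] ℝ :=
    { toFun := fun f => Λ f.toContinuousMap
      map_add' := fun f g => map_add Λ f.toContinuousMap g.toContinuousMap
      map_smul' := fun a f => map_smul Λ a f.toContinuousMap }
  let P := PositiveLinearMap.mk₀ L fun f hf => hΛ _ hf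
  refine ⟨RealRMK.rieszMeasure P, inferInstance, fun f => ?_⟩
  exact RealRMK.integral_rieszMeasure P (CompactlySupportedContinuousMap.continuousMapEquiv f)

/-! ### The scalar measures of a POVM -/

/-- The measure `B ↦ ⟨x, M(B) x⟩`. -/
noncomputable def vecMeasure (M : POVM U H) (x : H) : Measure U :=
  Measure.ofMeasurable (fun B _ => ENNReal.ofReal (⟪x, M.toFun B x⟫_ℂ).re)
    (by simp [M.inner_empty])
    (by
      intro B hB hd
      have h := ((Complex.hasSum_iff _ _).mp (M.iUnion B hB hd x x)).1
      rw [← h.tsum_eq]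
      exact ENNReal.ofReal_tsum_of_nonneg (fun i => re_inner_nonneg (M.nonneg _ (hB i)) _)
        h.summable)

theorem vecMeasure_apply (M : POVM U H) (x : H) {B : Set U} (hB : MeasurableSet B) :
    vecMeasure M x B = ENNReal.ofReal (⟪x, M.toFun B x⟫_ℂ).re :=
  Measure.ofMeasurable_apply B hB

theorem vecMeasure_real (M : POVM U H) (x : H) {B : Set U} (hB : MeasurableSet B) :
    (vecMeasure M x).real B = (⟪x, M.toFun B x⟫_ℂ).re := by
  rw [measureReal_def, vecMeasure_apply M x hB,
    ENNReal.toReal_ofReal (re_inner_nonneg (M.nonneg _ hB) _)]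

theorem vecMeasure_univ (M : POVM U H) (x : H) :
    vecMeasure M x Set.univ = ENNReal.ofReal (‖x‖ ^ 2) := by
  rw [vecMeasure_apply M x MeasurableSet.univ, M.univ]
  congr 1
  exact inner_self_eq_norm_sq (𝕜 := ℂ) x

instance (M : POVM U H) (x : H) : IsFiniteMeasure (vecMeasure M x) :=
  ⟨by rw [vecMeasure_univ]; exact ENNReal.ofReal_lt_top⟩

theorem vecMeasure_real_univ (M : POVM U H) (x : H) :
    (vecMeasure M x).real Set.univ = ‖x‖ ^ 2 := by
  rw [measureReal_def, vecMeasure_univ, ENNReal.toReal_ofReal (sq_nonneg _)]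

theorem bornMeasure_eq_sum (T : PosTraceClass H) (M : POVM U H) :
    bornMeasure T M = Measure.sum fun j => vecMeasure M (CFC.sqrt T.op (stdBasis H j)) := by
  ext B hB
  rw [bornMeasure_apply T M hB, ofReal_trace_mul T (M.nonneg _ hB), Measure.sum_apply _ hB]
  exact tsum_congr fun j => (vecMeasure_apply M _ hB).symm

theorem traceNorm_eq_tsum (T : PosTraceClass H) :
    traceNorm T.op = ∑' j, ENNReal.ofReal (‖CFC.sqrt T.op (stdBasis H j)‖ ^ 2) := by
  rw [traceNorm, CFC.abs_of_nonneg T.op T.nonneg]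
  refine tsum_congr fun j => ?_
  rw [inner_op_eq_sqrt, inner_self_eq_norm_sq_to_K]
  norm_cast

theorem bornMeasure_univ (T : PosTraceClass H) (M : POVM U H) :
    bornMeasure T M Set.univ = traceNorm T.op := by
  rw [bornMeasure_eq_sum, Measure.sum_apply _ MeasurableSet.univ, traceNorm_eq_tsum]
  exact tsum_congr fun j => vecMeasure_univ M _

instance (T : PosTraceClass H) (M : POVM U H) : IsFiniteMeasure (bornMeasure T M) :=
  ⟨by rw [bornMeasure_univ]; exact T.traceClass⟩

theorem integrable_continuousMap {X : Type*} [TopologicalSpace X] [CompactSpace X]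
    [MeasurableSpace X] [BorelSpace X] (μ : Measure X) [IsFiniteMeasure μ] (f : C(X, ℝ)) :
    Integrable f μ :=
  f.continuous.integrable_of_hasCompactSupport (HasCompactSupport.of_compactSpace _)

theorem abs_integral_le_norm_mul {X : Type*} [TopologicalSpace X] [CompactSpace X]
    [MeasurableSpace X] (μ : Measure X) [IsFiniteMeasure μ] (f : C(X, ℝ)) :
    |∫ x, f x ∂μ| ≤ ‖f‖ * μ.real Set.univ :=
  norm_integral_le_of_norm_le_const (.of_forall f.norm_coe_le_norm)

theorem integral_bornMeasure [TopologicalSpace U] [CompactSpace U] [BorelSpace U]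
    (T : PosTraceClass H) (M : POVM U H) (f : C(U, ℝ)) :
    ∫ u, f u ∂(bornMeasure T M) =
      ∑' j, ∫ u, f u ∂(vecMeasure M (CFC.sqrt T.op (stdBasis H j))) := by
  have := integrable_continuousMap (bornMeasure T M) f
  rw [bornMeasure_eq_sum] at this ⊢
  exact (hasSum_integral_measure this).tsum_eq.symm

/-! ### Operators from quadratic forms -/

section Forms

variable {E : Type*} [NormedAddCommGroup E] [InnerProductSpace ℂ E]

/-- The polarization of a real quadratic form. -/
noncomputable def polar (q : E → ℝ) (x y : E) : ℂ :=
  ⟨(q (x + y) - q (x - y)) / 4, -(q (x + Complex.I • y) - q (x - Complex.I • y)) / 4⟩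

/-- `q` satisfies all real linear relations that hold for all quadratic forms
`x ↦ Re ⟨x, A x⟩`. -/
def IsFormLike (q : E → ℝ) : Prop :=
  ∀ (n : ℕ) (c : Fin n → ℝ) (x : Fin n → E),
    (∀ A : E →L[ℂ] E, ∑ i, c i * (⟪x i, A (x i)⟫_ℂ).re = 0) → ∑ i, c i * q (x i) = 0

namespace IsFormLike

variable {q : E → ℝ}

/-- This and each algebraic law of `polar` below is a real linear relation between finitely many
values of `q`. It is verified by expansion for genuine quadratic forms, and `IsFormLike` transfers
it to `q`. Here the relations are `q (2x) - q 0 = 4 q x` and `q ((1 + i) x) = q ((1 - i) x)`. -/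
theorem polar_self (hq : IsFormLike q) (x : E) : polar q x x = q x := by
  have h1 := hq 3 ![1, -1, -4] ![x + x, x - x, x] fun A => by
    simp [Fin.sum_univ_succ]; ring
  have h2 := hq 2 ![1, -1] ![x + Complex.I • x, x - Complex.I • x] fun A => by
    simp [Fin.sum_univ_succ]
    ring
  simp [Fin.sum_univ_succ] at h1 h2
  apply Complex.ext <;> simp [polar] <;> linarith

theorem polar_add_right (hq : IsFormLike q) (x y z : E) :
    polar q x (y + z) = polar q x y + polar q x z := by
  have key : ∀ y z : E, q (x + (y + z)) - q (x - (y + z)) =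
      (q (x + y) - q (x - y)) + (q (x + z) - q (x - z)) := by
    intro y z
    have h := hq 6 ![1, -1, -1, 1, -1, 1]
      ![x + (y + z), x - (y + z), x + y, x - y, x + z, x - z] fun A => by
      simp [Fin.sum_univ_succ]
      ring
    simp [Fin.sum_univ_succ] at h
    linarith
  apply Complex.ext
  · simp only [polar, Complex.add_re]
    rw [key]; ring
  · simp only [polar, Complex.add_im]
    rw [smul_add, key]; ring

theorem polar_add_left (hq : IsFormLike q) (x y z : E) :
    polar q (x + y) z = polar q x z + polar q y z := by
  have key : ∀ z : E, q (x + y + z) - q (x + y - z) =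
      (q (x + z) - q (x - z)) + (q (y + z) - q (y - z)) := by
    intro z
    have h := hq 6 ![1, -1, -1, 1, -1, 1]
      ![x + y + z, x + y - z, x + z, x - z, y + z, y - z] fun A => by
      simp [Fin.sum_univ_succ]
      ring
    simp [Fin.sum_univ_succ] at h
    linarith
  apply Complex.ext
  · simp only [polar, Complex.add_re]
    rw [key]; ring
  · simp only [polar, Complex.add_im]
    rw [key]; ring

theorem polar_smul_right (hq : IsFormLike q) (a : ℂ) (x y : E) :
    polar q x (a • y) = a * polar q x y := by
  have key : ∀ b : ℂ, q (x + b • y) - q (x - b • y) =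
      b.re * (q (x + y) - q (x - y)) +
        b.im * (q (x + Complex.I • y) - q (x - Complex.I • y)) := by
    intro b
    have h := hq 6 ![1, -1, -b.re, b.re, -b.im, b.im]
      ![x + b • y, x - b • y, x + y, x - y, x + Complex.I • y, x - Complex.I • y] fun A => by
      simp [Fin.sum_univ_succ]
      ring
    simp [Fin.sum_univ_succ] at h
    linarith
  apply Complex.ext
  · simp only [polar, Complex.mul_re]
    rw [key]; ring
  · simp only [polar, Complex.mul_im]
    rw [smul_smul, key]
    simp only [Complex.mul_re, Complex.mul_im, Complex.I_re, Complex.I_im]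
    ring

theorem polar_smul_left (hq : IsFormLike q) (a : ℂ) (x y : E) :
    polar q (a • x) y = starRingEnd ℂ a * polar q x y := by
  have key : ∀ z : E, q (a • x + z) - q (a • x - z) =
      a.re * (q (x + z) - q (x - z)) -
        a.im * (q (x + Complex.I • z) - q (x - Complex.I • z)) := by
    intro z
    have h := hq 6 ![1, -1, -a.re, a.re, a.im, -a.im]
      ![a • x + z, a • x - z, x + z, x - z, x + Complex.I • z, x - Complex.I • z] fun A => by
      simp [Fin.sum_univ_succ]
      ring
    simp [Fin.sum_univ_succ] at h
    linarith
  -- The imaginary part of `polar` is evaluated at `z = i y`, where `key` produces a second factor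
  -- `i`; since `i² = -1`, the two terms exchange.
  have neg : ∀ z : E, q (x + Complex.I • Complex.I • z) - q (x - Complex.I • Complex.I • z) =
      -(q (x + z) - q (x - z)) := by
    intro z
    simp [smul_smul, ← sub_eq_add_neg]
  apply Complex.ext
  · simp only [polar, Complex.mul_re, Complex.conj_re, Complex.conj_im]
    rw [key]; ring
  · simp only [polar, Complex.mul_im, Complex.conj_re, Complex.conj_im]
    rw [key, neg]; ring

/-- A form-like `q` with `0 ≤ q x ≤ ‖x‖²` is the quadratic form of a positive operator. -/
theorem exists_operator {q : H → ℝ} (hq : IsFormLike q) (h0 : ∀ x, 0 ≤ q x)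
    (h1 : ∀ x, q x ≤ ‖x‖ ^ 2) :
    ∃ A : H →L[ℂ] H, 0 ≤ A ∧ ∀ x, ⟪x, A x⟫_ℂ = q x := by
  have bound : ∀ x y : H, ‖polar q x y‖ ≤ ‖x‖ ^ 2 + ‖y‖ ^ 2 := by
    intro x y
    -- A difference of nonnegative numbers is bounded by their sum, which the parallelogram law
    -- evaluates.
    have par : ∀ z : H, |q (x + z) - q (x - z)| ≤ 2 * (‖x‖ ^ 2 + ‖z‖ ^ 2) := by
      intro z
      have e : ‖x + z‖ ^ 2 + ‖x - z‖ ^ 2 = 2 * (‖x‖ ^ 2 + ‖z‖ ^ 2) := by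
        have := parallelogram_law_with_norm ℂ x z
        nlinarith
      rw [abs_le]
      constructor <;> nlinarith [h0 (x + z), h0 (x - z), h1 (x + z), h1 (x - z)]
    have b1 := par y
    have b2 := par (Complex.I • y)
    rw [norm_smul, Complex.norm_I, one_mul] at b2
    refine (Complex.norm_le_abs_re_add_abs_im _).trans ?_
    simp only [polar]
    rw [abs_div, abs_div, abs_neg, abs_of_pos (by norm_num : (0 : ℝ) < 4)]
    linarith
  have bound' : ∀ x y : H, ‖polar q x y‖ ≤ 2 * ‖x‖ * ‖y‖ := by
    intro x y
    rcases eq_or_ne x 0 with rfl | hx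
    · have := hq.polar_smul_left 0 0 y
      rw [zero_smul] at this
      rw [this, norm_mul]; simp
    rcases eq_or_ne y 0 with rfl | hy
    · have := hq.polar_smul_right 0 x 0
      rw [zero_smul] at this
      rw [this, norm_mul]; simp
    have hx' := norm_pos_iff.mpr hx
    have hy' := norm_pos_iff.mpr hy
    -- Normalizing to unit vectors makes the additive bound multiplicative; the constant 2 is `1 +
    -- 1`.
    have := bound (((‖x‖⁻¹ : ℝ) : ℂ) • x) (((‖y‖⁻¹ : ℝ) : ℂ) • y)
    rw [hq.polar_smul_left, hq.polar_smul_right] at this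
    simp only [norm_mul, norm_smul, RCLike.norm_conj, Complex.norm_real, norm_inv, norm_norm,
      inv_mul_cancel₀ hx'.ne', inv_mul_cancel₀ hy'.ne'] at this
    rw [inv_mul_le_iff₀ hx', inv_mul_le_iff₀ hy'] at this
    linarith
  let B : H →L⋆[ℂ] H →L[ℂ] ℂ := LinearMap.mkContinuous₂
    (LinearMap.mk₂'ₛₗ (starRingEnd ℂ) (RingHom.id ℂ) (polar q) hq.polar_add_left
      hq.polar_smul_left hq.polar_add_right hq.polar_smul_right) 2 bound'
  have hB : ∀ x, ⟪InnerProductSpace.continuousLinearMapOfBilin B x, x⟫_ℂ = q x := fun x =>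
    (InnerProductSpace.continuousLinearMapOfBilin_apply B x x).trans (hq.polar_self x)
  refine ⟨InnerProductSpace.continuousLinearMapOfBilin B, ?_, fun x => ?_⟩
  · rw [ContinuousLinearMap.nonneg_iff_isPositive, ContinuousLinearMap.isPositive_iff_complex]
    intro x
    rw [hB x]
    simp [h0 x]
  · rw [← inner_conj_symm, hB x, Complex.conj_ofReal]

end IsFormLike

/-- Countable additivity of operators may be checked on quadratic forms. -/
theorem hasSum_inner_of_diagonal {A : ℕ → E →L[ℂ] E} {S : E →L[ℂ] E}
    (h : ∀ x, HasSum (fun j => ⟪A j x, x⟫_ℂ) ⟪S x, x⟫_ℂ) (x y : E) :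
    HasSum (fun j => ⟪A j y, x⟫_ℂ) ⟪S y, x⟫_ℂ := by
  have e : ∀ T : E →L[ℂ] E, ⟪T y, x⟫_ℂ = _ := fun T => inner_map_polarization T.toLinearMap x y
  simp only [ContinuousLinearMap.coe_coe] at e
  simp_rw [e]
  exact ((((h _).sub (h _)).add ((h _).mul_left _)).sub ((h _).mul_left _)).div_const 4

end Forms

theorem hasSum_measureReal_iUnion (μ : Measure U) [IsFiniteMeasure μ] {B : ℕ → Set U}
    (hB : ∀ j, MeasurableSet (B j)) (hd : Pairwise (Function.onFun Disjoint B)) :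
    HasSum (fun j => μ.real (B j)) (μ.real (⋃ j, B j)) := by
  have hfin : ∑' j, μ (B j) ≠ ∞ := by
    rw [← measure_iUnion hd hB]
    exact measure_ne_top _ _
  rw [measureReal_def, measure_iUnion hd hB, ENNReal.tsum_toReal_eq fun j => measure_ne_top _ _]
  exact ENNReal.hasSum_toReal hfin

/-- A form-like family of measures is the family of scalar measures of a POVM. -/
theorem exists_povm (μ : H → Measure U) [∀ x, IsFiniteMeasure (μ x)]
    (hμ : ∀ B, MeasurableSet B → IsFormLike fun x => (μ x).real B)
    (hu : ∀ x, (μ x).real Set.univ = ‖x‖ ^ 2) :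
    ∃ M : POVM U H, ∀ x, vecMeasure M x = μ x := by
  have ex : ∀ B, MeasurableSet B → ∃ A : H →L[ℂ] H, 0 ≤ A ∧ ∀ x, ⟪x, A x⟫_ℂ = (μ x).real B :=
    fun B hB => (hμ B hB).exists_operator (fun x => measureReal_nonneg) fun x =>
      (hu x) ▸ measureReal_mono (Set.subset_univ B)
  choose A hA0 hA using ex
  classical
  let F : Set U → H →L[ℂ] H := fun B => if hB : MeasurableSet B then A B hB else 0
  have hF : ∀ B (hB : MeasurableSet B), F B = A B hB := fun B hB => dif_pos hB
  have hF' : ∀ B, MeasurableSet B → ∀ x, ⟪F B x, x⟫_ℂ = (μ x).real B := fun B hB x => by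
    rw [hF B hB, ← inner_conj_symm, hA, Complex.conj_ofReal]
  refine ⟨⟨F, fun B hB => hF B hB ▸ hA0 B hB, fun B hB => dif_neg hB, ?_, ?_⟩, fun x => ?_⟩
  · intro B hB hd x y
    -- Additivity is known only on the diagonal; complex polarization gives it for all pairs, and
    -- self-adjointness moves the operator to the other slot.
    have h := hasSum_inner_of_diagonal (A := fun j => F (B j)) (S := F (⋃ j, B j)) (fun z => by
      rw [hF' _ (MeasurableSet.iUnion hB)]
      simp_rw [fun j => hF' _ (hB j) z]
      exact Complex.hasSum_ofReal.mpr (hasSum_measureReal_iUnion (μ z) hB hd)) y x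
    have s : ∀ D, MeasurableSet D → ⟪x, F D y⟫_ℂ = ⟪F D x, y⟫_ℂ := fun D hD =>
      ((ContinuousLinearMap.isSelfAdjoint_iff_isSymmetric.mp
        (IsSelfAdjoint.of_nonneg (hF D hD ▸ hA0 D hD))) x y).symm
    rw [s _ (MeasurableSet.iUnion hB)]
    simp_rw [fun j => s _ (hB j)]
    exact h
  · have : ((F Set.univ : H →L[ℂ] H) : H →ₗ[ℂ] H) = ((1 : H →L[ℂ] H) : H →ₗ[ℂ] H) :=
      (ext_inner_map _ _).mp fun x => by
        simp only [ContinuousLinearMap.coe_coe, one_apply_eq_self]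
        rw [hF' _ MeasurableSet.univ, hu, inner_self_eq_norm_sq_to_K]
        norm_cast
    exact ContinuousLinearMap.coe_injective this
  · ext B hB
    rw [vecMeasure_apply _ _ hB]
    change ENNReal.ofReal (⟪x, F B x⟫_ℂ).re = _
    rw [hF B hB, hA, Complex.ofReal_re, ofReal_measureReal]

/-! ### Compactness of the space of POVMs -/

theorem continuous_integral_bornMeasure [TopologicalSpace U] (T : PosTraceClass H) (f : C(U, ℝ)) :
    Continuous fun M : POVM U H => ∫ u, f u ∂(bornMeasure T M) := by
  rw [continuous_iff_continuousAt]
  intro M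
  rw [ContinuousAt, Metric.tendsto_nhds]
  intro ε hε
  have ho : IsOpen (M.nbhd ε T f) := TopologicalSpace.isOpen_generateFrom_of_mem
    ⟨M, ε, T, f, hε, rfl⟩
  filter_upwards [ho.mem_nhds (by simpa [POVM.nbhd] using hε)] with N hN
  rw [dist_comm]
  exact hN

theorem POVM.le_nhds_of_tendsto [TopologicalSpace U] {l : Filter (POVM U H)} {M : POVM U H}
    (h : ∀ (T : PosTraceClass H) (f : C(U, ℝ)),
      Tendsto (fun N => ∫ u, f u ∂(bornMeasure T N)) l (𝓝 (∫ u, f u ∂(bornMeasure T M)))) :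
    l ≤ 𝓝 M := by
  rw [TopologicalSpace.nhds_generateFrom]
  refine le_iInf₂ fun s hs => le_principal_iff.mpr ?_
  obtain ⟨hM, M', ε, T, f, hε, rfl⟩ := hs
  have := (tendsto_const_nhds (x := ∫ u, f u ∂(bornMeasure T M'))).sub (h T f) |>.abs
  exact this.eventually_lt_const hM

theorem isFormLike_vecMeasure (M : POVM U H) {B : Set U} (hB : MeasurableSet B) :
    IsFormLike fun x => (vecMeasure M x).real B := by
  intro n c x h
  simp_rw [vecMeasure_real M _ hB]
  exact h _

/-- Every ultrafilter converges: the limits of the scalar measures exist by boundedness and inherit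
the relations that characterize a POVM. -/
instance [MetricSpace U] [CompactSpace U] [BorelSpace U] : CompactSpace (POVM U H) := by
  rw [← isCompact_univ_iff, isCompact_iff_ultrafilter_le_nhds]
  intro l _
  have lim : ∀ (x : H) (f : C(U, ℝ)), ∃ a : ℝ,
      Tendsto (fun N : POVM U H => ∫ u, f u ∂(vecMeasure N x)) l (𝓝 a) := by
    intro x f
    have hc : IsCompact (Metric.closedBall (0 : ℝ) (‖f‖ * ‖x‖ ^ 2)) := isCompact_closedBall _ _
    obtain ⟨a, -, ha⟩ := hc.ultrafilter_le_nhds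
      (l.map fun N : POVM U H => ∫ u, f u ∂(vecMeasure N x))
      (le_principal_iff.mpr <| Ultrafilter.mem_map.mpr <| Filter.univ_mem' fun N => by
        simpa [vecMeasure_real_univ] using abs_integral_le_norm_mul (vecMeasure N x) f)
    exact ⟨a, ha⟩
  choose Λ hΛ using lim
  have repr : ∀ x : H, ∃ μ : Measure U, IsFiniteMeasure μ ∧
      ∀ f : C(U, ℝ), ∫ u, f u ∂μ = Λ x f := by
    intro x
    refine exists_measure_of_nonneg
      { toFun := Λ x
        map_add' := fun f g => tendsto_nhds_unique (hΛ x (f + g))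
          (((hΛ x f).add (hΛ x g)).congr fun N => ?_)
        map_smul' := fun a f => tendsto_nhds_unique (hΛ x (a • f))
          (((hΛ x f).const_mul a).congr fun N => ?_) } fun f hf =>
        ge_of_tendsto' (hΛ x f) fun N => integral_nonneg hf
    · exact (integral_add (integrable_continuousMap _ f) (integrable_continuousMap _ g)).symm
    · exact (integral_const_mul a _).symm
  choose μ hfin hμ using repr
  have hform : ∀ B, MeasurableSet B → IsFormLike fun x => (μ x).real B := by
    intro B hB n c x h
    -- Limits are known for continuous test functions, not for Borel sets, so the relation is moved
    -- to functions, passed to the limit, and moved back.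
    refine (sum_mul_measureReal_eq_zero_iff c fun i => μ (x i)).mpr (fun f => ?_) B hB
    simp_rw [hμ]
    refine tendsto_nhds_unique (tendsto_finsetSum _ fun i _ => (hΛ (x i) f).const_mul (c i))
      (tendsto_const_nhds.congr fun N => ?_)
    exact ((sum_mul_measureReal_eq_zero_iff c fun i => vecMeasure N (x i)).mp
      (fun D hD => isFormLike_vecMeasure N hD n c x h) f).symm
  have huniv : ∀ x, (μ x).real Set.univ = ‖x‖ ^ 2 := by
    intro x
    have h := hμ x 1
    simp only [ContinuousMap.one_apply, integral_const, smul_eq_mul, mul_one] at h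
    rw [h]
    refine tendsto_nhds_unique (hΛ x 1) (tendsto_const_nhds.congr fun N => ?_)
    simp [vecMeasure_real_univ]
  obtain ⟨M, hM⟩ := exists_povm μ hform huniv
  refine ⟨M, Set.mem_univ _, POVM.le_nhds_of_tendsto fun T f => ?_⟩
  simp_rw [integral_bornMeasure]
  -- Vector states suffice: the trace is a series over `√T e_j`, dominated by `‖f‖ ‖√T e_j‖²`
  -- uniformly in the POVM.
  refine tendsto_tsum_of_dominated_convergence ((summable_sqrt_sq T).mul_left ‖f‖)
    (fun j => ?_) (.of_forall fun N j => ?_)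
  · rw [hM, hμ]
    exact hΛ _ f
  · simpa [vecMeasure_real_univ] using abs_integral_le_norm_mul (vecMeasure N _) f

/-! ### Continuity of the risk function -/

theorem traceNorm_of_nonneg {A : H →L[ℂ] H} (hA : 0 ≤ A) :
    traceNorm A = ∑' i, ENNReal.ofReal (⟪stdBasis H i, A (stdBasis H i)⟫_ℂ).re := by
  rw [traceNorm, CFC.abs_of_nonneg A hA]

theorem traceNorm_add {A B : H →L[ℂ] H} (hA : 0 ≤ A) (hB : 0 ≤ B) :
    traceNorm (A + B) = traceNorm A + traceNorm B := by
  rw [traceNorm_of_nonneg hA, traceNorm_of_nonneg hB, traceNorm_of_nonneg (add_nonneg hA hB),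
    ← ENNReal.tsum_add]
  refine tsum_congr fun i => ?_
  rw [← ENNReal.ofReal_add (re_inner_nonneg hA _) (re_inner_nonneg hB _),
    add_apply, inner_add_right, Complex.add_re]

theorem opTrace_mul_re_nonneg (T : PosTraceClass H) {A : H →L[ℂ] H} (hA : 0 ≤ A) :
    0 ≤ (opTrace (T.op * A)).re := by
  rw [opTrace, (hasSum_trace_mul (stdBasis H) T A).tsum_eq,
    Complex.re_tsum (summable_sqrt_inner T A)]
  exact tsum_nonneg fun j => re_inner_nonneg hA _

theorem bornMeasure_add {R S T : PosTraceClass H} (h : R.op = S.op + T.op) (M : POVM U H) :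
    bornMeasure R M = bornMeasure S M + bornMeasure T M := by
  ext B hB
  have hA := M.nonneg B hB
  have htr : opTrace (R.op * M.toFun B) =
      opTrace (S.op * M.toFun B) + opTrace (T.op * M.toFun B) := by
    have hs := (hasSum_trace_mul (stdBasis H) S (M.toFun B)).summable
    have ht := (hasSum_trace_mul (stdBasis H) T (M.toFun B)).summable
    rw [opTrace, opTrace, opTrace, ← hs.tsum_add ht]
    refine tsum_congr fun i => ?_
    rw [h, add_mul, add_apply, inner_add_right]
  rw [Measure.add_apply, bornMeasure_apply _ _ hB, bornMeasure_apply _ _ hB,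
    bornMeasure_apply _ _ hB, htr, Complex.add_re,
    ENNReal.ofReal_add (opTrace_mul_re_nonneg S hA) (opTrace_mul_re_nonneg T hA)]

theorem bornMeasure_real_univ (T : PosTraceClass H) (M : POVM U H) :
    (bornMeasure T M).real Set.univ = (traceNorm T.op).toReal := by
  rw [measureReal_def, bornMeasure_univ]

theorem bornMeasure_state_real_univ {Θ : Type*} (ρ : QModel Θ H) (θ : Θ) (M : POVM U H) :
    (bornMeasure (ρ.state θ) M).real Set.univ = 1 := by
  rw [measureReal_def, bornMeasure_apply _ _ MeasurableSet.univ, M.univ, mul_one,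
    ρ.trace_eq_one]
  simp

/-- With `D = T + X - S ≥ 0`, the identity `T + X = S + D` avoids measures of non-positive
operators. Equal traces of `S` and `T` force `D` and `X` to have the same trace, and each
contributes at most `‖f‖ Tr X`. -/
theorem abs_integral_bornMeasure_sub_le [TopologicalSpace U] [CompactSpace U] [BorelSpace U]
    {S T X : PosTraceClass H} (hX : S.op - T.op ≤ X.op)
    (hST : traceNorm S.op = traceNorm T.op) (M : POVM U H) (f : C(U, ℝ)) :
    |∫ u, f u ∂(bornMeasure S M) - ∫ u, f u ∂(bornMeasure T M)| ≤
      2 * ‖f‖ * (traceNorm X.op).toReal := by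
  have hD0 : 0 ≤ T.op + X.op - S.op := by
    rw [show T.op + X.op - S.op = X.op - (S.op - T.op) by abel]
    exact sub_nonneg.mpr hX
  have htr : traceNorm T.op + traceNorm X.op =
      traceNorm S.op + traceNorm (T.op + X.op - S.op) := by
    rw [← traceNorm_add T.nonneg X.nonneg, ← traceNorm_add S.nonneg hD0]
    congr 1
    abel
  have hDX : traceNorm (T.op + X.op - S.op) = traceNorm X.op := by
    rw [hST] at htr
    exact ((ENNReal.add_right_inj T.traceClass.ne).mp htr).symm
  let D : PosTraceClass H := ⟨T.op + X.op - S.op, hD0, by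
    rw [IsTraceClass, hDX]; exact X.traceClass⟩
  let R : PosTraceClass H := ⟨T.op + X.op, add_nonneg T.nonneg X.nonneg, by
    rw [IsTraceClass, traceNorm_add T.nonneg X.nonneg]
    exact ENNReal.add_lt_top.mpr ⟨T.traceClass, X.traceClass⟩⟩
  have h1 := bornMeasure_add (R := R) (S := T) (T := X) rfl M
  have h2 := bornMeasure_add (R := R) (S := S) (T := D)
    (show T.op + X.op = S.op + (T.op + X.op - S.op) by abel) M
  have h3 : ∫ u, f u ∂(bornMeasure T M) + ∫ u, f u ∂(bornMeasure X M) =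
      ∫ u, f u ∂(bornMeasure S M) + ∫ u, f u ∂(bornMeasure D M) := by
    rw [← integral_add_measure (integrable_continuousMap _ f) (integrable_continuousMap _ f),
      ← integral_add_measure (integrable_continuousMap _ f) (integrable_continuousMap _ f),
      ← h1, ← h2]
  have bX := abs_integral_le_norm_mul (bornMeasure X M) f
  have bD := abs_integral_le_norm_mul (bornMeasure D M) f
  rw [bornMeasure_real_univ] at bX bD
  rw [show traceNorm D.op = traceNorm X.op from hDX] at bD
  rw [abs_le] at bX bD ⊢
  constructor <;> linarith [bX.1, bX.2, bD.1, bD.2]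

section Risk

variable {Θ : Type*} [MetricSpace Θ] [TopologicalSpace U] [CompactSpace U] [BorelSpace U]

/-- The change in the loss is small uniformly in `u`, by currying `w` into `C(U, ℝ)`; the change in
the state is controlled by the majorant `X` from regularity, with all of `Θ` as the compact set. -/
theorem continuous_risk [CompactSpace Θ] (ρ : QModel Θ H) (hreg : IsRegular fun θ => (ρ.state θ).op)
    {w : Θ × U → ℝ} (hw : Continuous w) (M : POVM U H) : Continuous (risk ρ w M) := by
  let W : C(Θ, C(U, ℝ)) := ContinuousMap.curry ⟨w, hw⟩
  have hW : ∀ θ, risk ρ w M θ = ∫ u, W θ u ∂(bornMeasure (ρ.state θ) M) := fun θ => rfl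
  rw [continuous_iff_continuousAt]
  intro θ₀
  rw [ContinuousAt, Metric.tendsto_nhds]
  intro ε hε
  set r : ℝ := ε / (4 * (‖W θ₀‖ + 1)) with hr
  have hpos : 0 < ‖W θ₀‖ + 1 := by positivity
  have hr0 : 0 < r := by positivity
  have hev := ((hreg Set.univ isCompact_univ).eventually_lt_const
    (ENNReal.ofReal_pos.mpr hr0)).and self_mem_nhdsWithin
  obtain ⟨δ, hδ, hδ0⟩ := hev.exists
  simp only [omega, iInf_lt_iff] at hδ
  obtain ⟨X, ⟨hXt, hX⟩, hXr⟩ := hδ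
  -- Taking both parameters equal in the majorization gives `0 ≤ X`.
  have hX0 : 0 ≤ X := by
    have := (hX θ₀ trivial θ₀ trivial (by simpa using hδ0)).2
    simpa using this
  have hXr' : (traceNorm X).toReal < r := by
    rw [← ENNReal.toReal_ofReal hr0.le]
    exact (ENNReal.toReal_lt_toReal hXt.ne ENNReal.ofReal_ne_top).mpr hXr
  have htr : ∀ θ, traceNorm (ρ.state θ).op = 1 := fun θ => by
    rw [← bornMeasure_univ _ M, bornMeasure_apply _ _ MeasurableSet.univ, M.univ, mul_one,
      ρ.trace_eq_one]
    simp
  filter_upwards [Metric.ball_mem_nhds θ₀ hδ0,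
    (Metric.tendsto_nhds.mp (W.continuous.tendsto θ₀)) (ε / 2) (half_pos hε)] with θ h1 h2
  have b1 := abs_integral_bornMeasure_sub_le (S := ρ.state θ) (T := ρ.state θ₀)
    (X := ⟨X, hX0, hXt⟩) (hX θ trivial θ₀ trivial h1).2 (by rw [htr, htr]) M (W θ₀)
  have b2 := abs_integral_le_norm_mul (bornMeasure (ρ.state θ) M) (W θ - W θ₀)
  rw [bornMeasure_state_real_univ, mul_one] at b2
  have e2 : ∫ u, (W θ - W θ₀) u ∂(bornMeasure (ρ.state θ) M) =
      ∫ u, W θ u ∂(bornMeasure (ρ.state θ) M) - ∫ u, W θ₀ u ∂(bornMeasure (ρ.state θ) M) :=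
    integral_sub (integrable_continuousMap _ _) (integrable_continuousMap _ _)
  rw [e2] at b2
  rw [dist_eq_norm] at h2
  have b3 : 2 * ‖W θ₀‖ * (traceNorm X).toReal ≤ ε / 2 := by
    calc 2 * ‖W θ₀‖ * (traceNorm X).toReal ≤ 2 * (‖W θ₀‖ + 1) * r := by gcongr; linarith
      _ = ε / 2 := by rw [hr]; field_simp; ring
  rw [Real.dist_eq, hW, hW]
  calc _ ≤ |∫ u, W θ u ∂(bornMeasure (ρ.state θ) M) - ∫ u, W θ₀ u ∂(bornMeasure (ρ.state θ) M)|
        + |∫ u, W θ₀ u ∂(bornMeasure (ρ.state θ) M) -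
            ∫ u, W θ₀ u ∂(bornMeasure (ρ.state θ₀) M)| := abs_sub_le _ _ _
    _ < ε := by
      have : 2 * ‖W θ₀‖ * (traceNorm (PosTraceClass.mk X hX0 hXt).op).toReal ≤ ε / 2 := b3
      linarith

/-- The risk function is affine in the POVM. -/
theorem risk_of_convex_combination (ρ : QModel Θ H) {w : Θ × U → ℝ} (hw : Continuous w)
    {M N P : POVM U H} {a b : ℝ} (ha : 0 ≤ a) (hb : 0 ≤ b)
    (hP : P.toFun = a • M.toFun + b • N.toFun) (θ : Θ) :
    risk ρ w P θ = a * risk ρ w M θ + b * risk ρ w N θ := by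
  set T := ρ.state θ
  have hm : bornMeasure T P =
      a.toNNReal • bornMeasure T M + b.toNNReal • bornMeasure T N := by
    rw [bornMeasure_eq_sum]
    ext B hB
    rw [Measure.add_apply, Measure.smul_apply, Measure.smul_apply, bornMeasure_eq_sum,
      bornMeasure_eq_sum, Measure.sum_apply _ hB, Measure.sum_apply _ hB, Measure.sum_apply _ hB,
      ENNReal.smul_def, ENNReal.smul_def, smul_eq_mul, smul_eq_mul, ← ENNReal.tsum_mul_left,
      ← ENNReal.tsum_mul_left, ← ENNReal.tsum_add]
    refine tsum_congr fun j => ?_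
    have nM := re_inner_nonneg (M.nonneg B hB) (CFC.sqrt T.op (stdBasis H j))
    have nN := re_inner_nonneg (N.nonneg B hB) (CFC.sqrt T.op (stdBasis H j))
    rw [vecMeasure_apply _ _ hB, vecMeasure_apply _ _ hB, vecMeasure_apply _ _ hB, hP]
    change _ = ENNReal.ofReal a * _ + ENNReal.ofReal b * _
    rw [← ENNReal.ofReal_mul ha, ← ENNReal.ofReal_mul hb,
      ← ENNReal.ofReal_add (mul_nonneg ha nM) (mul_nonneg hb nN)]
    congr 1
    simp [inner_smul_right_eq_smul]
  let f : C(U, ℝ) := ⟨fun u => w (θ, u), by fun_prop⟩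
  have hint : ∀ Q : POVM U H, Integrable f (bornMeasure T Q) := fun Q =>
    integrable_continuousMap _ f
  change ∫ u, f u ∂(bornMeasure T P) =
    a * ∫ u, f u ∂(bornMeasure T M) + b * ∫ u, f u ∂(bornMeasure T N)
  rw [hm, integral_add_measure (hint M).smul_measure_nnreal (hint N).smul_measure_nnreal,
    integral_smul_nnreal_measure, integral_smul_nnreal_measure, NNReal.smul_def, NNReal.smul_def,
    Real.coe_toNNReal a ha, Real.coe_toNNReal b hb, smul_eq_mul, smul_eq_mul]

end Risk

/-! ### Minimax POVMs and least favorable priors -/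

/-- If no function of the convex set `K` lies strictly below `v`, then some probability measure
gives every function of `K` an average of at least `v`. -/
theorem exists_probabilityMeasure_le_integral {X : Type*} [TopologicalSpace X] [T2Space X]
    [CompactSpace X] [MeasurableSpace X] [BorelSpace X] {K : Set C(X, ℝ)} (hK : Convex ℝ K)
    (hne : K.Nonempty) {v : ℝ} (h : ∀ g ∈ K, ∃ x, v ≤ g x) :
    ∃ π : ProbabilityMeasure X, ∀ g ∈ K, v ≤ ∫ x, g x ∂(π : Measure X) := by
  let O : Set C(X, ℝ) := {g | ∀ x, g x < v}
  have hO : IsOpen O := by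
    have := ContinuousMap.isOpen_setOfPred_mapsTo (isCompact_univ (X := X)) (isOpen_Iio (a := v))
    simpa [Set.MapsTo] using this
  have hOc : Convex ℝ O := fun f hf g hg a b ha hb hab x =>
    (convex_Iio v) (hf x) (hg x) ha hb hab
  -- In the sup norm on a compact space, the functions strictly below `v` form an open convex set,
  -- disjoint from `K`. The separating functional will be a multiple of the desired prior.
  obtain ⟨l, s, hlO, hlK⟩ := geometric_hahn_banach_open hOc hO hK
    (Set.disjoint_left.mpr fun g hgO hgK => by
      obtain ⟨x, hx⟩ := h g hgK
      exact absurd (hgO x) hx.not_gt)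
  have hconst : ∀ ε > 0, (v - ε) * l 1 < s := by
    intro ε hε
    rw [← smul_eq_mul, ← map_smul]
    exact hlO _ fun x => by simpa using hε
  have hpos : ∀ f : C(X, ℝ), 0 ≤ f → 0 ≤ l f := by
    intro f hf
    by_contra! hneg
    obtain ⟨n, hn⟩ := exists_nat_gt ((s - (v - 1) * l 1) / (-l f))
    rw [div_lt_iff₀ (by linarith)] at hn
    -- Subtracting multiples of `f ≥ 0` stays below `v`; if `l f < 0`, these would push `l` above
    -- `s`.
    have hmem : (v - 1) • (1 : C(X, ℝ)) - (n : ℝ) • f ∈ O := fun x => by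
      have : 0 ≤ (n : ℝ) * f x := mul_nonneg n.cast_nonneg (hf x)
      simp only [ContinuousMap.sub_apply, ContinuousMap.smul_apply, ContinuousMap.one_apply,
        smul_eq_mul, mul_one]
      linarith
    have := hlO _ hmem
    rw [map_sub, map_smul, map_smul, smul_eq_mul, smul_eq_mul] at this
    linarith
  obtain ⟨μ, hμ, hμl⟩ := exists_measure_of_nonneg l.toLinearMap hpos
  have hμl' : ∀ f : C(X, ℝ), ∫ x, f x ∂μ = l f := hμl
  have hmass : μ.real Set.univ = l 1 := by simpa using hμl' 1
  -- If `l 1 = 0` then `μ = 0`, so `l` vanishes on `K` as well as on constants, against the strict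
  -- separation `l (v - 1) < s ≤ l g`.
  have hl1 : 0 < l 1 := by
    refine (hpos 1 zero_le_one).lt_of_ne' fun h0 => ?_
    obtain ⟨g, hg⟩ := hne
    have hz : μ = 0 := by
      rw [← Measure.measure_univ_eq_zero, ← measureReal_eq_zero_iff, hmass, h0]
    have h1 := hconst 1 one_pos
    have h2 := hlK g hg
    rw [← hμl', hz, integral_zero_measure] at h2
    rw [h0, mul_zero] at h1
    linarith
  have hμ0 : μ ≠ 0 := by
    rintro rfl
    simp at hmass
    linarith
  have hvs : v * l 1 ≤ s := by
    refine le_of_forall_pos_lt_add fun ε hε => ?_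
    have := hconst (ε / l 1) (by positivity)
    rw [sub_mul, div_mul_cancel₀ _ hl1.ne'] at this
    linarith
  have hprob : IsProbabilityMeasure ((μ Set.univ)⁻¹ • μ) := by
    have : NeZero μ := ⟨hμ0⟩
    exact isProbabilityMeasureSMul
  refine ⟨⟨_, hprob⟩, fun g hg => ?_⟩
  change v ≤ ∫ x, g x ∂((μ Set.univ)⁻¹ • μ)
  rw [integral_smul_measure, hμl', ENNReal.toReal_inv, ← measureReal_def, hmass, smul_eq_mul,
    inv_mul_eq_div, le_div_iff₀ hl1]
  exact hvs.trans (hlK g hg)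

section Decision

variable {Θ : Type*} [MetricSpace Θ] [MetricSpace U] [CompactSpace U] [BorelSpace U]

/-- A supremum of continuous functions is lower semicontinuous, hence attains its minimum on the
compact set `C`. -/
theorem exists_isMinimax (ρ : QModel Θ H) {w : Θ × U → ℝ} (hw : Continuous w)
    {C : Set (POVM U H)} (hne : C.Nonempty) (hclosed : IsClosed C) :
    ∃ M, IsMinimax ρ w C M := by
  have hlsc : LowerSemicontinuous (worstRisk ρ w : POVM U H → EReal) := by
    refine lowerSemicontinuous_iSup fun θ => Continuous.lowerSemicontinuous ?_
    exact continuous_coe_real_ereal.comp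
      (continuous_integral_bornMeasure (ρ.state θ) ⟨fun u => w (θ, u), by fun_prop⟩)
  obtain ⟨M, hM, hmin⟩ :=
    (hlsc.lowerSemicontinuousOn C).exists_isMinOn hne hclosed.isCompact
  exact ⟨M, hM, fun N hN => hmin hN⟩

variable [CompactSpace Θ]

theorem exists_worstRisk_eq [Nonempty Θ] (ρ : QModel Θ H) (hreg : IsRegular fun θ => (ρ.state θ).op)
    {w : Θ × U → ℝ} (hw : Continuous w) (M : POVM U H) :
    ∃ θ, worstRisk ρ w M = risk ρ w M θ := by
  obtain ⟨θ, -, hθ⟩ := isCompact_univ.exists_isMaxOn Set.univ_nonempty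
    (continuous_risk ρ hreg hw M).continuousOn
  exact ⟨θ, le_antisymm (iSup_le fun η => EReal.coe_le_coe_iff.mpr (hθ (Set.mem_univ η)))
    (le_iSup (fun θ => (risk ρ w M θ : EReal)) θ)⟩

theorem convex_riskFunctions (ρ : QModel Θ H) (hreg : IsRegular fun θ => (ρ.state θ).op)
    {w : Θ × U → ℝ} (hw : Continuous w) {C : Set (POVM U H)} (hconv : IsConvex C) :
    Convex ℝ ((fun M => (⟨risk ρ w M, continuous_risk ρ hreg hw M⟩ : C(Θ, ℝ))) '' C) := by
  rintro _ ⟨M, hM, rfl⟩ _ ⟨N, hN, rfl⟩ a b ha hb hab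
  obtain ⟨P, hP, hPe⟩ := hconv ⟨M, hM, rfl⟩ ⟨N, hN, rfl⟩ ha hb hab
  refine ⟨P, hP, ?_⟩
  ext θ
  exact risk_of_convex_combination ρ hw ha hb hPe θ

variable [MeasurableSpace Θ] [BorelSpace Θ]

theorem avgRisk_le (ρ : QModel Θ H) (hreg : IsRegular fun θ => (ρ.state θ).op)
    {w : Θ × U → ℝ} (hw : Continuous w) {M : POVM U H} {v : ℝ} (h : ∀ θ, risk ρ w M θ ≤ v)
    (π : ProbabilityMeasure Θ) : avgRisk ρ w π M ≤ v := by
  have := integral_mono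
    (integrable_continuousMap (π : Measure Θ) ⟨risk ρ w M, continuous_risk ρ hreg hw M⟩)
    (integrable_const v) h
  simpa [avgRisk] using this

/-- The minimax risk is finite and is the smallest average risk for some prior. -/
theorem exists_saddle [Nonempty Θ] (ρ : QModel Θ H) (hreg : IsRegular fun θ => (ρ.state θ).op)
    {w : Θ × U → ℝ} (hw : Continuous w) {C : Set (POVM U H)} (hne : C.Nonempty)
    (hclosed : IsClosed C) (hconv : IsConvex C) :
    ∃ (v : ℝ) (π : ProbabilityMeasure Θ), (∀ N ∈ C, v ≤ avgRisk ρ w π N) ∧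
      ∀ M, IsMinimax ρ w C M → ∀ θ, risk ρ w M θ ≤ v := by
  obtain ⟨M₀, hM₀, hmin⟩ := exists_isMinimax ρ hw hne hclosed
  obtain ⟨θ₀, hθ₀⟩ := exists_worstRisk_eq ρ hreg hw M₀
  -- The level is the minimax value; each competitor reaches it at the point where its own risk is
  -- maximal.
  obtain ⟨π, hπ⟩ := exists_probabilityMeasure_le_integral
    (convex_riskFunctions ρ hreg hw hconv) (hne.image _) (v := risk ρ w M₀ θ₀) (by
      rintro _ ⟨N, hN, rfl⟩
      obtain ⟨θ, hθ⟩ := exists_worstRisk_eq ρ hreg hw N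
      refine ⟨θ, EReal.coe_le_coe_iff.mp ?_⟩
      rw [← hθ₀]
      exact (hmin N hN).trans hθ.le)
  refine ⟨risk ρ w M₀ θ₀, π, fun N hN => hπ _ ⟨N, hN, rfl⟩, fun M hM θ => ?_⟩
  refine EReal.coe_le_coe_iff.mp ?_
  rw [← hθ₀]
  exact (le_iSup (fun θ => (risk ρ w M θ : EReal)) θ).trans (hM.2 M₀ hM₀)

end Decision

end QStat

theorem mainTheorem9
    {H : Type*} [NormedAddCommGroup H] [InnerProductSpace ℂ H] [CompleteSpace H]
    {Θ : Type*} [MetricSpace Θ] [CompactSpace Θ] [Nonempty Θ] [MeasurableSpace Θ] [BorelSpace Θ]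
    {U : Type*} [MetricSpace U] [CompactSpace U] [MeasurableSpace U] [BorelSpace U]
    (ρ : QStat.QModel Θ H) (hreg : QStat.IsRegular fun θ => (ρ.state θ).op)
    (w : Θ × U → ℝ) (hw : Continuous w)
    (C : Set (QStat.POVM U H)) (hne : C.Nonempty) (hclosed : IsClosed C)
    (hconv : QStat.IsConvex C) :
    (∃ π : ProbabilityMeasure Θ, QStat.IsLeastFavorable ρ w C π) ∧
    (∀ π : ProbabilityMeasure Θ, QStat.IsLeastFavorable ρ w C π →
      ∀ M, QStat.IsMinimax ρ w C M → QStat.IsBayes ρ w C π M) ∧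
    (∀ M, QStat.IsMinimax ρ w C M →
      ∃ π : ProbabilityMeasure Θ, QStat.IsLeastFavorable ρ w C π ∧ QStat.IsBayes ρ w C π M) ∧
    (∀ π : ProbabilityMeasure Θ, QStat.IsLeastFavorable ρ w C π →
      ∀ M, QStat.IsBayes ρ w C π M → (∀ N, QStat.IsBayes ρ w C π N → N = M) →
        QStat.IsMinimax ρ w C M) := by
  obtain ⟨M₀, hM₀⟩ := QStat.exists_isMinimax ρ hw hne hclosed
  obtain ⟨v, π₀, hπ₀, hv⟩ := QStat.exists_saddle ρ hreg hw hne hclosed hconv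
  have hle : ∀ π, QStat.infAvgRisk ρ w C π ≤ v := fun π =>
    (iInf₂_le M₀ hM₀.1).trans
      (EReal.coe_le_coe_iff.mpr (QStat.avgRisk_le ρ hreg hw (hv M₀ hM₀) π))
  have hge : (v : EReal) ≤ QStat.infAvgRisk ρ w C π₀ :=
    le_iInf₂ fun N hN => EReal.coe_le_coe_iff.mpr (hπ₀ N hN)
  have hlf : QStat.IsLeastFavorable ρ w C π₀ :=
    le_antisymm (le_iSup _ π₀) (iSup_le fun π => (hle π).trans hge)
  have hbayes : ∀ π : ProbabilityMeasure Θ, QStat.IsLeastFavorable ρ w C π →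
      ∀ M, QStat.IsMinimax ρ w C M → QStat.IsBayes ρ w C π M := by
    intro π hπ M hM
    refine ⟨hM.1, fun N hN => EReal.coe_le_coe_iff.mp ?_⟩
    -- The value `v` bounds the average risk of a minimax POVM from above and, by least
    -- favorability, all average risks under `π` from below.
    calc (QStat.avgRisk ρ w π M : EReal) ≤ v :=
          EReal.coe_le_coe_iff.mpr (QStat.avgRisk_le ρ hreg hw (hv M hM) π)
      _ ≤ QStat.infAvgRisk ρ w C π₀ := hge
      _ ≤ QStat.infAvgRisk ρ w C π := (le_iSup _ π₀).trans hπ.ge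
      _ ≤ _ := iInf₂_le N hN
  -- The single prior `π₀` serves all minimax POVMs at once. For the last claim, the minimax `M₀` is
  -- Bayes for `π`, so uniqueness identifies it with `M`.
  refine ⟨⟨π₀, hlf⟩, hbayes, fun M hM => ⟨π₀, hlf, hbayes π₀ hlf M hM⟩, ?_⟩
  intro π hπ M _ huniq
  exact huniq M₀ (hbayes π hπ M₀ hM₀) ▸ hM₀
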